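/- Let $G$ be a finite group with $|G|>1$, let $\hat G$ be the set of isomorphism classes of complex irreducible representations of $G$, and let $d_\lambda$ be the dimension of $\lambda\in\hat G$. For each $\lambda$ choose a representative $g\mapsto\lambda(g)$ by unitary $d_\lambda\times d_\lambda$ matrices. The quantum Fourier transform over $G$ is the linear map from $\mathbb C[G]$ to $\bigoplus_{\lambda\in\hat G}\mathbb C^{d_\lambda}\otimes\mathbb C^{d_\lambda}$ with $$U|g\rangle=\sum_{\lambda\in\hat G}\ \sum_{i,j=1}^{d_\lambda}\sqrt{\frac{d_\lambda}{|G|}}\;\lambda(g)_{ij}\,|\lambda,i\rangle|j\rangle .$$ For $0<\alpha,\beta\le 1$, a unitary $U:\mathbb C^X\to\bigoplus_{a\in L}\mathbb C^{J_a}$ ($X$, $L$ and all $J_a$ finite) is called $(\alpha,\beta)$-pseudo-dispersing if there is a set $A\subseteq L$ with $|A|\ge|X|^{\alpha}$ such that for every $a\in A$ there is a unit vector $|\psi\rangle\in\mathbb C^{J_a}$ with $$\sum_{x\in X}\bigl|\langle a|\langle\psi|U|x\rangle\bigr|\ \ge\ \beta\sqrt{|X|}.$$ (For an $n$-qubit circuit,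 $X=\{0,1\}^n$, $L=\{0,1\}^m$ and $J_a=\{0,1\}^{n-m}$.) Then, for every choice of the representatives, the quantum Fourier transform over $G$ (with $X=G$, labels $a=(\lambda,i)$ and $\mathbb C^{J_a}=\mathbb C^{d_\lambda}$) is $(\alpha,1/\sqrt2)$-pseudo-dispersing, where $$\alpha=\frac{\log\sum_{\lambda\in\hat G}d_\lambda}{\log|G|}\ \ge\ \frac12 .$$ -/

import Mathlib

noncomputable section

namespace QuantumFourier

/-- The linear representation of `G` on `ℂ^d` given by a homomorphism into the group of
`d × d` unitary matrices. -/
def linearRep {G : Type*} [Group G] {d : ℕ} (ρ : G →* Matrix.unitaryGroup (Fin d) ℂ) :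
    Representation ℂ G (Fin d → ℂ) where
  toFun g := Matrix.toLin' (ρ g : Matrix (Fin d) (Fin d) ℂ)
  map_one' := by
    rw [map_one]
    exact Matrix.toLin'_one
  map_mul' g h := by
    rw [map_mul]
    exact Matrix.toLin'_mul _ _

/-- An irreducible unitary matrix representation of `G`, that is, a complex irrep together with
an orthonormal basis of its representation space. -/
structure UnitaryIrrep (G : Type*) [Group G] where
  /-- The dimension. -/
  dim : ℕ
  /-- The unitary matrices. -/
  mat : G →* Matrix.unitaryGroup (Fin dim) ℂ
  /-- The representation is irreducible (in particular, it is not zero). -/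
  irreducible : (linearRep mat).IsIrreducible

/-- Isomorphism of representations. -/
instance irrepSetoid (G : Type*) [Group G] : Setoid (UnitaryIrrep G) where
  r ρ σ := Nonempty ((linearRep ρ.mat).Equiv (linearRep σ.mat))
  iseqv :=
    { refl := fun _ => ⟨Representation.Equiv.refl _⟩
      symm := fun ⟨e⟩ => ⟨e.symm⟩
      trans := fun ⟨e⟩ ⟨f⟩ => ⟨e.trans f⟩ }

/-- The set `Ĝ` of isomorphism classes of irreps of `G`. -/
def IrrepClass (G : Type*) [Group G] : Type _ :=
  Quotient (irrepSetoid G)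

/-- The isomorphism class of an irrep. -/
def UnitaryIrrep.toClass {G : Type*} [Group G] (ρ : UnitaryIrrep G) : IrrepClass G :=
  Quotient.mk (irrepSetoid G) ρ

/-- The dimension `d_λ` of an isomorphism class `λ` of irreps. -/
def IrrepClass.dim {G : Type*} [Group G] (l : IrrepClass G) : ℕ :=
  Quotient.lift (s := irrepSetoid G) UnitaryIrrep.dim (by
    rintro ρ σ ⟨e⟩
    simpa using e.toLinearEquiv.finrank_eq) l

/-- A finite group has only finitely many irreps up to isomorphism. -/
instance finite_irrepClass (G : Type*) [Group G] [Finite G] : Finite (IrrepClass G) := by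
  classical
  have := Fintype.ofFinite G
  have hG : (Nat.card G : ℂ) ≠ 0 := Nat.cast_ne_zero.mpr Nat.card_pos.ne'
  let _ : Invertible (Nat.card G : ℂ) := invertibleOfNonzero hG
  let χ : IrrepClass G → G → ℂ := fun l => (linearRep l.out.mat).character
  have orth : ∀ l m : IrrepClass G,
      (Nat.card G : ℂ)⁻¹ * ∑ g : G, χ l g * χ m g⁻¹ = if l = m then 1 else 0 := by
    intro l m
    have := l.out.irreducible
    have := m.out.irreducible
    rw [Representation.char_orthonormal]
    refine if_congr ⟨fun h => ?_, ?_⟩ rfl rfl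
    · exact (Quotient.out_equiv_out (s := irrepSetoid G) (x := m) (y := l)).mp h |>.symm
    · rintro rfl
      exact ⟨Representation.Equiv.refl _⟩
  have hli : LinearIndependent ℂ χ := by
    rw [linearIndependent_iff']
    intro s c hc m hm
    have h0 : (Nat.card G : ℂ)⁻¹ * ∑ g : G, (∑ l ∈ s, c l • χ l) g * χ m g⁻¹ = 0 := by
      rw [hc]
      simp
    have h1 : (Nat.card G : ℂ)⁻¹ * ∑ g : G, (∑ l ∈ s, c l • χ l) g * χ m g⁻¹ =
        ∑ l ∈ s, c l * ((Nat.card G : ℂ)⁻¹ * ∑ g : G, χ l g * χ m g⁻¹) := by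
      simp only [Finset.sum_apply, Pi.smul_apply, smul_eq_mul, Finset.sum_mul, Finset.mul_sum]
      rw [Finset.sum_comm]
      exact Finset.sum_congr rfl fun l _ => Finset.sum_congr rfl fun g _ => by ring
    rw [h1] at h0
    simp_rw [orth] at h0
    simpa [hm] using h0
  exact hli.finite

instance (G : Type*) [Group G] [Finite G] : Fintype (IrrepClass G) :=
  Fintype.ofFinite _

/-- The matrix of the quantum Fourier transform over `G`, with `R l` the chosen matrix
representative of the class `l`:
`|g⟩ ↦ ∑_{λ,i,j} √(d_λ / |G|) λ(g)_{ij} |λ, i⟩|j⟩`.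
Columns are indexed by `G`. Rows are indexed by pairs of a label `(λ, i)`, the content of the
first register, and a basis state `j` of the remaining register, `i, j ∈ {1, …, d_λ}`. -/
def qft {G : Type*} [Group G] [Fintype G] (R : IrrepClass G → UnitaryIrrep G) :
    Matrix (Σ a : (Σ l : IrrepClass G, Fin (R l).dim), Fin (R a.1).dim) G ℂ :=
  Matrix.of fun r g =>
    (Real.sqrt (((R r.1.1).dim : ℝ) / (Fintype.card G : ℝ)) : ℂ) *
      ((R r.1.1).mat g : Matrix (Fin (R r.1.1).dim) (Fin (R r.1.1).dim) ℂ) r.1.2 r.2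

open scoped Classical in
/-- `(α, β)`-pseudo-dispersing unitaries `U : ℂ^X → ⨁_{a ∈ L} ℂ^{J a}`: the input space has
computational basis `X`, and a basis state of the output space is a label `a ∈ L` in the first
register and a basis state in `J a` of the remaining register, whose dimension may depend on `a`.
For circuits on `n` qubits `X = {0,1}^n`, `L = {0,1}^m` and `J a = {0,1}^(n-m)`, and the number
of basis states `Fintype.card X` is `2^n`.
The inner sum is the amplitude `⟨a|⟨ψ| U |x⟩`. -/
def IsPseudoDispersing {X L : Type*} {J : L → Type*} [Fintype X] [Fintype L]
    [∀ a, Fintype (J a)]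
    (U : Matrix (Σ a, J a) X ℂ) (α β : ℝ) : Prop :=
  0 < α ∧ α ≤ 1 ∧ 0 < β ∧ β ≤ 1 ∧ U.conjTranspose * U = 1 ∧ U * U.conjTranspose = 1 ∧
    ∃ A : Finset L, (Fintype.card X : ℝ) ^ α ≤ (A.card : ℝ) ∧
      ∀ a ∈ A, ∃ ψ : EuclideanSpace ℂ (J a), ‖ψ‖ = 1 ∧
        β * Real.sqrt (Fintype.card X) ≤ ∑ x, ‖∑ j, star (ψ j) * U ⟨a, j⟩ x‖

end QuantumFourier

end

/-! Every label `(λ, i)` can be used: there are `∑ d_λ = |G|^α` of them. For a fixed label, the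
amplitude at `g` is `√(d_λ/|G|)` times the overlap of `ψ` with row `i` of `λ(g)`, a unit vector.
Take `ψ` with entries of modulus `1/√d_λ` and independent uniform phases among the fourth roots of
unity. A fourth-moment bound makes the mean overlap with any unit vector at least `1/√(2 d_λ)`
(`le_sum_phases_norm`), so some choice of phases does this on average over `g`
(`exists_unit_vector_overlap`).

Unitarity combines Schur orthogonality, which makes the rows orthonormal, with completeness:
splitting the regular representation into unitary irreps shows that the transform is injective.
Comparing traces gives `∑ d_λ² = |G|`, hence `|G| ≤ (∑ d_λ)²` and `∑ d_λ ≤ |G|`, which place `α` in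
`[1/2, 1]`. -/

namespace QuantumFourier

/-! ### Khintchine-type bound for random fourth-root phases -/

section Moments

/-- The fourth roots of unity. -/
noncomputable def fourthRoot : Fin 4 → ℂ := ![1, Complex.I, -1, -Complex.I]

lemma normSq_fourthRoot (k : Fin 4) : Complex.normSq (fourthRoot k) = 1 := by
  fin_cases k <;> simp [fourthRoot]

lemma sum_normSq_fourthRoot_mul_add (a s : ℂ) :
    ∑ k, Complex.normSq (fourthRoot k * a + s) =
      4 * (Complex.normSq a + Complex.normSq s) := by
  simp [Fin.sum_univ_four, fourthRoot, Complex.normSq_apply]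
  ring

/-- Both `ω` and `ω²` average to zero over the fourth roots. Signs alone would not kill the `ω²`
term and would give a worse cross term for real `a`, `s`. -/
lemma sum_normSq_sq_fourthRoot_mul_add (a s : ℂ) :
    ∑ k, Complex.normSq (fourthRoot k * a + s) ^ 2 =
      4 * (Complex.normSq a ^ 2 + 4 * Complex.normSq a * Complex.normSq s +
        Complex.normSq s ^ 2) := by
  simp [Fin.sum_univ_four, fourthRoot, Complex.normSq_apply]
  ring

lemma sum_phases_succ {n : ℕ} (F : ℂ → ℝ) (a : Fin (n + 1) → ℂ) :
    ∑ w : Fin (n + 1) → Fin 4, F (∑ j, fourthRoot (w j) * a j) =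
      ∑ w : Fin n → Fin 4, ∑ k, F (fourthRoot k * a 0 + ∑ j, fourthRoot (w j) * a j.succ) := by
  rw [Finset.sum_comm, ← Fintype.sum_prod_type',
    ← (Fin.consEquiv fun _ : Fin (n + 1) => Fin 4).sum_comp]
  refine Fintype.sum_congr _ _ fun p => ?_
  simp [Fin.sum_univ_succ, Fin.consEquiv]

/-- The second moment of a combination with independent uniform phases in `{1, i, -1, -i}`. -/
lemma sum_phases_normSq {n : ℕ} (a : Fin n → ℂ) :
    ∑ w : Fin n → Fin 4, Complex.normSq (∑ j, fourthRoot (w j) * a j) =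
      4 ^ n * ∑ j, Complex.normSq (a j) := by
  induction n with
  | zero => simp
  | succ n ih =>
    rw [sum_phases_succ Complex.normSq]
    simp_rw [sum_normSq_fourthRoot_mul_add]
    rw [← Finset.mul_sum, Finset.sum_add_distrib, ih fun j => a j.succ, Fin.sum_univ_succ]
    simp
    ring

/-- The fourth moment of a combination with independent uniform phases in `{1, i, -1, -i}`. -/
lemma sum_phases_normSq_sq_le {n : ℕ} (a : Fin n → ℂ) :
    ∑ w : Fin n → Fin 4, Complex.normSq (∑ j, fourthRoot (w j) * a j) ^ 2 ≤
      2 * 4 ^ n * (∑ j, Complex.normSq (a j)) ^ 2 := by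
  induction n with
  | zero => simp
  | succ n ih =>
    rw [sum_phases_succ fun z => Complex.normSq z ^ 2]
    simp_rw [sum_normSq_sq_fourthRoot_mul_add]
    rw [← Finset.mul_sum, Finset.sum_add_distrib, Finset.sum_add_distrib, ← Finset.mul_sum,
      sum_phases_normSq fun j => a j.succ, Fin.sum_univ_succ]
    have h := ih fun j => a j.succ
    have h4 : (0 : ℝ) < 4 ^ n := by positivity
    -- The slack in the induction step is four times this term.
    have h5 : (0 : ℝ) ≤ 4 ^ n * Complex.normSq (a 0) ^ 2 := by positivity
    simp only [Finset.sum_const, Finset.card_univ, Fintype.card_fun, Fintype.card_fin,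
      nsmul_eq_mul, Nat.cast_pow, Nat.cast_ofNat]
    rw [pow_succ (4 : ℝ) n]
    linarith

/-- The tangent at `y = √2` bounds the absolute value below by second and fourth moments. -/
lemma moment_le_mul_sqrt_two {y : ℝ} (hy : 0 ≤ y) :
    6 * y ^ 2 - (y ^ 2) ^ 2 ≤ 4 * Real.sqrt 2 * y := by
  have hs : Real.sqrt 2 ^ 2 = 2 := Real.sq_sqrt (by norm_num)
  have hs0 := Real.sqrt_nonneg 2
  -- Right side minus left side, factored; the double root is the point of tangency.
  have key : 0 ≤ y * ((y - Real.sqrt 2) ^ 2 * (y + 2 * Real.sqrt 2)) := by positivity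
  have e : y * ((y - Real.sqrt 2) ^ 2 * (y + 2 * Real.sqrt 2)) =
      y ^ 4 - 3 * Real.sqrt 2 ^ 2 * y ^ 2 + 2 * Real.sqrt 2 ^ 2 * Real.sqrt 2 * y := by ring
  rw [e, hs] at key
  nlinarith

/-- With second moment 1 and fourth moment at most 2, the tangent bound gives mean modulus at least
`(6 - 2) / (4√2) = 1/√2`. -/
lemma le_sum_phases_norm {n : ℕ} (a : Fin n → ℂ) (ha : ∑ j, Complex.normSq (a j) = 1) :
    (4 : ℝ) ^ n ≤ Real.sqrt 2 * ∑ w : Fin n → Fin 4, ‖∑ j, fourthRoot (w j) * a j‖ := by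
  have h2 := sum_phases_normSq a
  have h4 := sum_phases_normSq_sq_le a
  rw [ha] at h2 h4
  have h : ∑ w : Fin n → Fin 4, (6 * Complex.normSq (∑ j, fourthRoot (w j) * a j) -
      Complex.normSq (∑ j, fourthRoot (w j) * a j) ^ 2) ≤
      ∑ w : Fin n → Fin 4, 4 * Real.sqrt 2 * ‖∑ j, fourthRoot (w j) * a j‖ := by
    refine Finset.sum_le_sum fun w _ => ?_
    rw [Complex.normSq_eq_norm_sq]
    exact moment_le_mul_sqrt_two (norm_nonneg _)
  rw [Finset.sum_sub_distrib, ← Finset.mul_sum, ← Finset.mul_sum, h2] at h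
  linarith

/-- For any finite family of unit vectors in `ℂ^n`, some unit vector `ψ` has average overlap at
least `1 / √(2n)` with the members of the family. -/
lemma exists_unit_vector_overlap {X : Type*} [Fintype X] {n : ℕ} (hn : 0 < n)
    (u : X → Fin n → ℂ) (hu : ∀ x, ∑ j, Complex.normSq (u x j) = 1) :
    ∃ ψ : EuclideanSpace ℂ (Fin n), ‖ψ‖ = 1 ∧
      (Fintype.card X : ℝ) ≤
        Real.sqrt 2 * (Real.sqrt n * ∑ x, ‖∑ j, star (ψ j) * u x j‖) := by
  have hsn : 0 < Real.sqrt n := Real.sqrt_pos.mpr (by exact_mod_cast hn)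
  obtain ⟨w, -, hw⟩ : ∃ w ∈ (Finset.univ : Finset (Fin n → Fin 4)),
      (Fintype.card X : ℝ) ≤ Real.sqrt 2 * ∑ x, ‖∑ j, fourthRoot (w j) * u x j‖ := by
    -- Averaging over the phases: after exchanging the sums, the bound holds for each `x`
    -- separately.
    refine Finset.exists_le_of_sum_le ⟨fun _ => 0, Finset.mem_univ _⟩ ?_
    rw [← Finset.mul_sum, Finset.sum_comm, Finset.mul_sum]
    calc ∑ _w : Fin n → Fin 4, (Fintype.card X : ℝ) = ∑ _x : X, (4 : ℝ) ^ n := by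
          simp [mul_comm]
      _ ≤ _ := Finset.sum_le_sum fun x _ => le_sum_phases_norm (u x) (hu x)
  -- Conjugated phases, since the overlap conjugates `ψ` again.
  refine ⟨WithLp.toLp 2 fun j => star (fourthRoot (w j)) / (Real.sqrt n : ℂ), ?_, ?_⟩
  · have h1 : ∀ k, ‖fourthRoot k‖ = 1 := fun k => by
      have := normSq_fourthRoot k
      rw [Complex.normSq_eq_norm_sq] at this
      exact (pow_eq_one_iff_of_nonneg (norm_nonneg _) two_ne_zero).mp this
    rw [EuclideanSpace.norm_eq, Real.sqrt_eq_one]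
    simp only [norm_div, norm_star, h1, Complex.norm_real, Real.norm_eq_abs, abs_of_pos hsn]
    rw [Finset.sum_const, Finset.card_univ, Fintype.card_fin, nsmul_eq_mul, div_pow,
      Real.sq_sqrt (Nat.cast_nonneg n)]
    have : (n : ℝ) ≠ 0 := by exact_mod_cast hn.ne'
    field_simp
  · convert hw using 2
    rw [Finset.mul_sum]
    refine Finset.sum_congr rfl fun x _ => ?_
    have : (∑ j, star (star (fourthRoot (w j)) / (Real.sqrt n : ℂ)) * u x j) =
        (Real.sqrt n : ℂ)⁻¹ * ∑ j, fourthRoot (w j) * u x j := by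
      rw [Finset.mul_sum]
      refine Finset.sum_congr rfl fun j _ => ?_
      simp
      ring
    simp only [this, norm_mul, norm_inv, Complex.norm_real, Real.norm_eq_abs, abs_of_pos hsn]
    field_simp

end Moments

/-! ### Schur orthogonality of matrix coefficients -/

section Schur

variable {G : Type*} [Group G]

lemma UnitaryIrrep.dim_pos (ρ : UnitaryIrrep G) : 0 < ρ.dim := by
  by_contra h
  have h0 : ρ.dim = 0 := by omega
  have : IsEmpty (Fin ρ.dim) := by rw [h0]; infer_instance
  have hs : Subsingleton (Subrepresentation (linearRep ρ.mat)) :=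
    ⟨fun a b => Subrepresentation.toSubmodule_injective (Subsingleton.elim _ _)⟩
  have := ρ.irreducible.toNontrivial
  exact not_subsingleton _ hs

lemma toClass_dim (ρ : UnitaryIrrep G) : ρ.toClass.dim = ρ.dim := rfl

lemma UnitaryIrrep.conjTranspose_mul_mat (ρ : UnitaryIrrep G) (g : G) :
    (ρ.mat g).1.conjTranspose * (ρ.mat g).1 = 1 :=
  Matrix.mem_unitaryGroup_iff'.mp (ρ.mat g).2

lemma UnitaryIrrep.mat_mul_conjTranspose (ρ : UnitaryIrrep G) (g : G) :
    (ρ.mat g).1 * (ρ.mat g).1.conjTranspose = 1 :=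
  Matrix.mem_unitaryGroup_iff.mp (ρ.mat g).2

lemma sum_normSq_row (ρ : UnitaryIrrep G) (g : G) (i : Fin ρ.dim) :
    ∑ j, Complex.normSq ((ρ.mat g).1 i j) = 1 := by
  have h := congrFun (congrFun (ρ.mat_mul_conjTranspose g) i) i
  rw [Matrix.mul_apply, Matrix.one_apply_eq] at h
  simp only [Matrix.conjTranspose_apply, Complex.star_def, Complex.mul_conj] at h
  exact_mod_cast h

variable [Fintype G]

/-- The average (up to normalization) of a matrix over the group, an intertwiner. -/
noncomputable def groupAverage (σ ρ : UnitaryIrrep G) (X : Matrix (Fin σ.dim) (Fin ρ.dim) ℂ) :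
    Matrix (Fin σ.dim) (Fin ρ.dim) ℂ :=
  ∑ g : G, (σ.mat g).1 * X * (ρ.mat g).1.conjTranspose

lemma groupAverage_intertwines (σ ρ : UnitaryIrrep G) (X : Matrix (Fin σ.dim) (Fin ρ.dim) ℂ)
    (h : G) :
    (σ.mat h).1 * groupAverage σ ρ X =
      groupAverage σ ρ X * (ρ.mat h).1 := by
  rw [groupAverage, Matrix.mul_sum, Matrix.sum_mul]
  -- Substituting `h * g` for `g` on the right produces `ρ(h)ᴴ ρ(h)`, which cancels.
  rw [← Equiv.sum_comp (Equiv.mulLeft h) fun g => (σ.mat g).1 * X *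
    (ρ.mat g).1.conjTranspose * (ρ.mat h).1]
  refine Finset.sum_congr rfl fun g _ => ?_
  simp only [Equiv.coe_mulLeft, map_mul, Submonoid.coe_mul, Matrix.conjTranspose_mul,
    Matrix.mul_assoc, ρ.conjTranspose_mul_mat h, Matrix.mul_one]

/-- The average of a matrix over the group, as an intertwining map. -/
noncomputable def averageIntertwiner (σ ρ : UnitaryIrrep G) (X : Matrix (Fin σ.dim) (Fin ρ.dim) ℂ) :
    (linearRep ρ.mat).IntertwiningMap (linearRep σ.mat) where
  toLinearMap := Matrix.toLin' (groupAverage σ ρ X)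
  isIntertwining' g := by
    change Matrix.toLin' _ ∘ₗ Matrix.toLin' _ = Matrix.toLin' _ ∘ₗ Matrix.toLin' _
    rw [← Matrix.toLin'_mul, ← Matrix.toLin'_mul, groupAverage_intertwines]

lemma groupAverage_eq_zero {σ ρ : UnitaryIrrep G} (h : ρ.toClass ≠ σ.toClass)
    (X : Matrix (Fin σ.dim) (Fin ρ.dim) ℂ) : groupAverage σ ρ X = 0 := by
  have := ρ.irreducible
  have := σ.irreducible
  rcases Representation.IsIrreducible.bijective_or_eq_zero (averageIntertwiner σ ρ X) with hb | h0
  · exact absurd (Quotient.sound (s := irrepSetoid G)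
      ⟨(averageIntertwiner σ ρ X).ofBijective hb⟩) h
  · have : Matrix.toLin' (groupAverage σ ρ X) = 0 :=
      congrArg Representation.IntertwiningMap.toLinearMap h0
    simpa using this

/-- Schur's lemma over `ℂ` makes the average a scalar matrix; its trace determines the scalar. -/
lemma groupAverage_self (ρ : UnitaryIrrep G) (X : Matrix (Fin ρ.dim) (Fin ρ.dim) ℂ) :
    groupAverage ρ ρ X = ((Fintype.card G : ℂ) / ρ.dim * X.trace) • 1 := by
  have := ρ.irreducible
  obtain ⟨c, hc⟩ := (Representation.IsIrreducible.algebraMap_intertwiningMap_bijective_of_isAlgClosed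
    (k := ℂ) (ρ := linearRep ρ.mat)).2 (averageIntertwiner ρ ρ X)
  have h1 : groupAverage ρ ρ X = c • 1 := by
    have : c • LinearMap.id = Matrix.toLin' (groupAverage ρ ρ X) :=
      congrArg Representation.IntertwiningMap.toLinearMap hc
    apply Matrix.toLin'.injective
    rw [← this, map_smul, Matrix.toLin'_one]
  have h2 : (groupAverage ρ ρ X).trace = Fintype.card G * X.trace := by
    rw [groupAverage, Matrix.trace_sum]
    have : ∀ g : G, ((ρ.mat g).1 * X *
        (ρ.mat g).1.conjTranspose).trace = X.trace := fun g => by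
      rw [Matrix.trace_mul_comm, ← Matrix.mul_assoc, ρ.conjTranspose_mul_mat, Matrix.one_mul]
    simp [this]
  have hd : (ρ.dim : ℂ) ≠ 0 := Nat.cast_ne_zero.mpr ρ.dim_pos.ne'
  rw [h1, Matrix.trace_smul, Matrix.trace_one, Fintype.card_fin, smul_eq_mul] at h2
  rw [h1, div_mul_eq_mul_div, ← h2, mul_div_assoc, div_self hd, mul_one]

/-- Averages of matrix units are the inner products of matrix coefficients, hence of transform rows
up to scale. -/
lemma groupAverage_single_apply (σ ρ : UnitaryIrrep G) (i j : Fin σ.dim) (i' j' : Fin ρ.dim) :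
    groupAverage σ ρ (Matrix.single j j' 1) i i' =
      ∑ g : G, (σ.mat g).1 i j * star ((ρ.mat g).1 i' j') := by
  rw [groupAverage, Matrix.sum_apply]
  refine Finset.sum_congr rfl fun g _ => ?_
  simp [Matrix.mul_apply, Matrix.single_apply, ite_and, Finset.sum_ite_eq]

end Schur

/-! ### Completeness of the Fourier coefficients -/

section Completeness

variable {G : Type*} [Group G]

section Unitarization

variable {E : Type*} [NormedAddCommGroup E] [InnerProductSpace ℂ E]
  (L : Representation ℂ G E) (W : Submodule ℂ E)

/-- The matrix of a representation in an orthonormal basis of an invariant subspace. -/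
noncomputable def basisMatrix {W : Submodule ℂ E} {n : ℕ} (b : OrthonormalBasis (Fin n) ℂ W) (g : G) :
    Matrix (Fin n) (Fin n) ℂ :=
  Matrix.of fun i j => inner ℂ (b i : E) (L g (b j))

variable {L W} {n : ℕ} (b : OrthonormalBasis (Fin n) ℂ W)

lemma apply_basis_eq_sum (hW : ∀ g, ∀ w ∈ W, L g w ∈ W) (g : G) (j : Fin n) :
    L g (b j) = ∑ i, basisMatrix L b g i j • (b i : E) := by
  have := congrArg (Subtype.val : W → E) (b.sum_repr' ⟨L g (b j), hW g _ (b j).2⟩)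
  simpa [basisMatrix] using this.symm

lemma basisMatrix_one : basisMatrix L b 1 = 1 := by
  ext i j
  have := orthonormal_iff_ite.mp b.orthonormal i j
  simpa [basisMatrix, Matrix.one_apply] using this

lemma basisMatrix_mul (hW : ∀ g, ∀ w ∈ W, L g w ∈ W) (g h : G) :
    basisMatrix L b (g * h) = basisMatrix L b g * basisMatrix L b h := by
  ext i j
  change inner ℂ (b i : E) (L (g * h) (b j)) = _
  rw [Matrix.mul_apply, map_mul, Module.End.mul_apply, apply_basis_eq_sum b hW h j, map_sum,
    inner_sum]
  refine Finset.sum_congr rfl fun k _ => ?_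
  rw [map_smul, inner_smul_right, mul_comm]
  rfl

lemma conjTranspose_basisMatrix (hL : ∀ g v w, inner ℂ (L g v) (L g w) = inner ℂ v w) (g : G) :
    (basisMatrix L b g).conjTranspose = basisMatrix L b g⁻¹ := by
  ext i j
  simp only [basisMatrix, Matrix.conjTranspose_apply, Matrix.of_apply]
  rw [← starRingEnd_apply, inner_conj_symm, ← hL g (b i : E) (L g⁻¹ (b j)),
    Representation.self_inv_apply]

/-- The unitary matrices of a unitary representation in an orthonormal basis of an invariant
subspace. -/
noncomputable def basisUnitary (hL : ∀ g v w, inner ℂ (L g v) (L g w) = inner ℂ v w)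
    (hW : ∀ g, ∀ w ∈ W, L g w ∈ W) : G →* Matrix.unitaryGroup (Fin n) ℂ where
  toFun g := ⟨basisMatrix L b g, by
    rw [Matrix.mem_unitaryGroup_iff', Matrix.star_eq_conjTranspose,
      conjTranspose_basisMatrix b hL, ← basisMatrix_mul b hW, inv_mul_cancel, basisMatrix_one]⟩
  map_one' := Subtype.ext (basisMatrix_one b)
  map_mul' g h := Subtype.ext (basisMatrix_mul b hW g h)

/-- The inclusion of `W` in coordinates with respect to an orthonormal basis. -/
noncomputable def coordInclusion : (Fin n → ℂ) →ₗ[ℂ] E :=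
  W.subtype ∘ₗ b.toBasis.equivFun.symm.toLinearMap

lemma coordInclusion_apply (v : Fin n → ℂ) : coordInclusion b v = ∑ i, v i • (b i : E) := by
  rw [coordInclusion, LinearMap.comp_apply, LinearEquiv.coe_coe, Module.Basis.equivFun_symm_apply]
  simp

lemma coordInclusion_injective : Function.Injective (coordInclusion b) :=
  Subtype.val_injective.comp b.toBasis.equivFun.symm.injective

lemma range_coordInclusion : LinearMap.range (coordInclusion b) = W := by
  rw [coordInclusion, LinearMap.range_comp, LinearEquiv.range, Submodule.map_top,
    Submodule.range_subtype]

lemma coordInclusion_linearRep (hL : ∀ g v w, inner ℂ (L g v) (L g w) = inner ℂ v w)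
    (hW : ∀ g, ∀ w ∈ W, L g w ∈ W) (g : G) (v : Fin n → ℂ) :
    coordInclusion b (linearRep (basisUnitary b hL hW) g v) = L g (coordInclusion b v) := by
  have : linearRep (basisUnitary b hL hW) g v = (basisMatrix L b g).mulVec v := rfl
  rw [this, coordInclusion_apply, coordInclusion_apply, map_sum]
  simp_rw [map_smul, apply_basis_eq_sum b hW g, Finset.smul_sum, Matrix.mulVec, dotProduct,
    Finset.sum_smul, smul_smul]
  rw [Finset.sum_comm]
  simp_rw [mul_comm]

/-- The coordinate inclusion is injective and equivariant, so it carries subrepresentations to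
invariant subspaces of `W`. -/
lemma basisUnitary_irreducible (hL : ∀ g v w, inner ℂ (L g v) (L g w) = inner ℂ v w)
    (hW : ∀ g, ∀ w ∈ W, L g w ∈ W) (hW0 : W ≠ ⊥)
    (hmin : ∀ V ≤ W, (∀ g, ∀ v ∈ V, L g v ∈ V) → V = ⊥ ∨ V = W) :
    (linearRep (basisUnitary b hL hW)).IsIrreducible := by
  have hinj := Submodule.map_injective_of_injective (coordInclusion_injective b)
  have htop : (⊤ : Submodule ℂ (Fin n → ℂ)).map (coordInclusion b) = W := by
    rw [Submodule.map_top, range_coordInclusion]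
  refine { exists_pair_ne := ⟨⊥, ⊤, fun h => hW0 ?_⟩, eq_bot_or_eq_top := fun S => ?_ }
  · have h' : (⊥ : Submodule ℂ (Fin n → ℂ)) = ⊤ := congrArg Subrepresentation.toSubmodule h
    rw [← htop, ← h', Submodule.map_bot]
  · have hV := hmin (S.toSubmodule.map (coordInclusion b))
      (LinearMap.map_le_range.trans (range_coordInclusion b).le) (by
        rintro g _ ⟨v, hv, rfl⟩
        exact ⟨_, S.apply_mem_toSubmodule g hv, coordInclusion_linearRep b hL hW g v⟩)
    refine hV.imp (fun h => Subrepresentation.toSubmodule_injective (hinj ?_))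
      fun h => Subrepresentation.toSubmodule_injective (hinj ?_)
    · exact h.trans (Submodule.map_bot _).symm
    · exact h.trans htop.symm

end Unitarization

variable [Fintype G]

/-- A function on `G` whose Fourier coefficients all vanish acts as zero in every
finite-dimensional unitary representation. -/
lemma sum_smul_apply_eq_zero {E : Type*} [NormedAddCommGroup E] [InnerProductSpace ℂ E]
    [FiniteDimensional ℂ E] (L : Representation ℂ G E)
    (hL : ∀ g v w, inner ℂ (L g v) (L g w) = inner ℂ v w) (f : G → ℂ)
    (hf : ∀ ρ : UnitaryIrrep G, ∑ g, f g • (ρ.mat g).1 = 0)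
    (W : Submodule ℂ E) (hW : ∀ g, ∀ w ∈ W, L g w ∈ W) :
    ∀ w ∈ W, ∑ g, f g • L g w = 0 := by
  induction hn : Module.finrank ℂ W using Nat.strong_induction_on generalizing W with
  | _ n ih =>
  subst hn
  intro w hw
  by_cases hW0 : W = ⊥
  · have : w = 0 := by simpa [hW0] using hw
    simp [this]
  by_cases hmin : ∀ V ≤ W, (∀ g, ∀ v ∈ V, L g v ∈ V) → V = ⊥ ∨ V = W
  -- `W` is irreducible: in an orthonormal basis it becomes a `UnitaryIrrep`, to which `hf` applies.
  · let b := stdOrthonormalBasis ℂ W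
    have h0 := hf ⟨_, basisUnitary b hL hW, basisUnitary_irreducible b hL hW hW0 hmin⟩
    have hw' : w ∈ LinearMap.range (coordInclusion b) := by rwa [range_coordInclusion]
    obtain ⟨v, rfl⟩ := hw'
    have hv : ∑ g, f g • L g (coordInclusion b v) =
        coordInclusion b (∑ g, f g • linearRep (basisUnitary b hL hW) g v) := by
      rw [map_sum]
      refine Finset.sum_congr rfl fun g _ => ?_
      rw [map_smul, coordInclusion_linearRep b hL hW]
    rw [hv]
    have : ∑ g, f g • linearRep (basisUnitary b hL hW) g v =
        (∑ g, f g • (basisUnitary b hL hW g).1).mulVec v := by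
      rw [Matrix.sum_mulVec]
      refine Finset.sum_congr rfl fun g _ => ?_
      rw [Matrix.smul_mulVec]
      rfl
    rw [this]
    erw [h0]
    simp
  · push Not at hmin
    obtain ⟨V, hVW, hV, hV0, hVne⟩ := hmin
    -- Otherwise `W` splits into `V` and its orthogonal complement in `W`, invariant by unitarity;
    -- both have smaller dimension.
    have hV' : ∀ g, ∀ v ∈ Vᗮ ⊓ W, L g v ∈ Vᗮ ⊓ W := by
      rintro g v ⟨hv, hvW⟩
      refine ⟨fun u hu => ?_, hW g v hvW⟩
      rw [← Representation.self_inv_apply L g u, hL]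
      exact hv _ (hV _ _ hu)
    have hlt : Vᗮ ⊓ W < W := by
      refine lt_of_le_of_ne inf_le_right fun h => hV0 ?_
      rw [Submodule.eq_bot_iff]
      intro v hv
      have hvo : v ∈ Vᗮ := (h.ge.trans inf_le_left) (hVW hv)
      exact inner_self_eq_zero.mp (hvo v hv)
    have hsup : V ⊔ Vᗮ ⊓ W = W := Submodule.sup_orthogonal_inf_of_hasOrthogonalProjection hVW
    rw [← hsup] at hw
    obtain ⟨x, hx, y, hy, rfl⟩ := Submodule.mem_sup.mp hw
    have hx0 := ih _ (Submodule.finrank_lt_finrank_of_lt (lt_of_le_of_ne hVW hVne)) V hV rfl x hx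
    have hy0 := ih _ (Submodule.finrank_lt_finrank_of_lt hlt) _ hV' rfl y hy
    simp_rw [map_add, smul_add, Finset.sum_add_distrib]
    rw [hx0, hy0, add_zero]

/-- The left regular representation on `ℂ^G`. -/
noncomputable def regularRep (G : Type*) [Group G] [Fintype G] : Representation ℂ G (EuclideanSpace ℂ G) where
  toFun g :=
    { toFun := fun v => WithLp.toLp 2 fun x => v (g⁻¹ * x)
      map_add' := fun _ _ => rfl
      map_smul' := fun _ _ => rfl }
  map_one' := by
    ext v x
    simp
  map_mul' g h := by
    refine LinearMap.ext fun v => ?_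
    ext x
    change v ((g * h)⁻¹ * x) = v (h⁻¹ * (g⁻¹ * x))
    simp [mul_assoc]

lemma regularRep_apply (g : G) (v : EuclideanSpace ℂ G) (x : G) :
    regularRep G g v x = v (g⁻¹ * x) := rfl

lemma inner_regularRep (g : G) (v w : EuclideanSpace ℂ G) :
    inner ℂ (regularRep G g v) (regularRep G g w) = inner ℂ v w := by
  simp only [PiLp.inner_apply, regularRep_apply]
  exact Equiv.sum_comp (Equiv.mulLeft g⁻¹) fun x => inner ℂ (v x) (w x)

/-- A function on a finite group is determined by its Fourier coefficients. -/
lemma eq_zero_of_sum_smul_mat_eq_zero (f : G → ℂ)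
    (hf : ∀ ρ : UnitaryIrrep G, ∑ g, f g • (ρ.mat g).1 = 0) : f = 0 := by
  classical
  -- Translates of the point mass at `1` are the point masses at `g`, so the vanishing sum is `f`
  -- itself.
  have h := sum_smul_apply_eq_zero (regularRep G) inner_regularRep f hf ⊤
    (fun _ _ _ => Submodule.mem_top) (EuclideanSpace.single 1 1) Submodule.mem_top
  funext x
  have hx := congrArg (fun v : EuclideanSpace ℂ G => v x) h
  simpa [regularRep_apply, Pi.single_apply, inv_mul_eq_one] using hx

/-- The vanishing of a Fourier coefficient depends only on the isomorphism class. -/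
lemma sum_smul_mat_eq_zero_of_toClass_eq {ρ σ : UnitaryIrrep G} (h : σ.toClass = ρ.toClass)
    {f : G → ℂ} (hσ : ∑ g, f g • (σ.mat g).1 = 0) :
    ∑ g, f g • (ρ.mat g).1 = 0 := by
  obtain ⟨e⟩ : Nonempty ((linearRep σ.mat).Equiv (linearRep ρ.mat)) := Quotient.exact h
  have key : ∀ τ : UnitaryIrrep G, Matrix.toLin' (∑ g, f g • (τ.mat g).1) =
      ∑ g, f g • linearRep τ.mat g := fun τ => by
    rw [map_sum]
    exact Finset.sum_congr rfl fun g _ => map_smul _ _ _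
  apply Matrix.toLin'.injective
  have h0 := key σ
  rw [hσ, map_zero] at h0
  rw [key, map_zero]
  refine LinearMap.ext fun v => ?_
  obtain ⟨u, rfl⟩ : ∃ u, e.toLinearEquiv u = v := e.toLinearEquiv.surjective v
  have h1 := congrArg e.toLinearEquiv (LinearMap.congr_fun h0 u)
  simp only [LinearMap.zero_apply, map_zero, LinearMap.sum_apply, LinearMap.smul_apply, map_sum,
    map_smul] at h1 ⊢
  rw [h1]
  refine Finset.sum_congr rfl fun g _ => congrArg _ ?_
  exact (e.toIntertwiningMap.isIntertwining _ _ g u).symm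

end Completeness

/-! ### Unitarity and dispersion of the transform -/

section QFT

variable {G : Type*} [Group G] [Fintype G] {R : IrrepClass G → UnitaryIrrep G}

lemma qft_apply (l : IrrepClass G) (i j : Fin (R l).dim) (g : G) :
    qft R ⟨⟨l, i⟩, j⟩ g = (Real.sqrt (((R l).dim : ℝ) / (Fintype.card G : ℝ)) : ℂ) *
      ((R l).mat g).1 i j := rfl

open scoped Classical in
lemma qft_mul_conjTranspose (hR : ∀ l, (R l).toClass = l) :
    qft R * (qft R).conjTranspose = 1 := by
  ext ⟨⟨l, i⟩, j⟩ ⟨⟨m, i'⟩, j'⟩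
  have h : (qft R * (qft R).conjTranspose) ⟨⟨l, i⟩, j⟩ ⟨⟨m, i'⟩, j'⟩ =
      (Real.sqrt (((R l).dim : ℝ) / (Fintype.card G : ℝ)) : ℂ) *
      (Real.sqrt (((R m).dim : ℝ) / (Fintype.card G : ℝ)) : ℂ) *
        groupAverage (R l) (R m) (Matrix.single j j' 1) i i' := by
    rw [groupAverage_single_apply, Matrix.mul_apply, Finset.mul_sum]
    refine Finset.sum_congr rfl fun g _ => ?_
    rw [Matrix.conjTranspose_apply, qft_apply, qft_apply, star_mul']
    simp only [Complex.star_def, Complex.conj_ofReal]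
    ring
  rw [h]
  by_cases hlm : l = m
  · subst hlm
    have hd : ((R l).dim : ℂ) ≠ 0 := Nat.cast_ne_zero.mpr (R l).dim_pos.ne'
    have hG : (Fintype.card G : ℂ) ≠ 0 := Nat.cast_ne_zero.mpr Fintype.card_ne_zero
    rw [groupAverage_self, ← Complex.ofReal_mul, Real.mul_self_sqrt (by positivity)]
    by_cases hi : i = i' <;> by_cases hj : j = j'
    · subst hi hj
      simp
      field_simp
    · simp [Matrix.one_apply, hj]
    · simp [hi]
    · simp [hi]
  · rw [groupAverage_eq_zero (by rw [hR, hR]; exact Ne.symm hlm)]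
    simp [hlm]

/-- The rows are nonzero multiples of matrix coefficients of one irrep per class; vanishing there
passes to every irrep, and completeness applies. -/
lemma qft_mulVec_injective (hR : ∀ l, (R l).toClass = l) {f : G → ℂ}
    (hf : (qft R).mulVec f = 0) : f = 0 := by
  refine eq_zero_of_sum_smul_mat_eq_zero f fun ρ =>
    sum_smul_mat_eq_zero_of_toClass_eq (hR ρ.toClass) ?_
  set l := ρ.toClass
  ext i j
  have h := congrFun hf ⟨⟨l, i⟩, j⟩
  have hs : (Real.sqrt (((R l).dim : ℝ) / (Fintype.card G : ℝ)) : ℂ) ≠ 0 := by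
    rw [Complex.ofReal_ne_zero]
    have := (R l).dim_pos
    have : 0 < Fintype.card G := Fintype.card_pos
    positivity
  simp only [Matrix.mulVec, dotProduct, qft_apply, mul_assoc, ← Finset.mul_sum, Pi.zero_apply,
    mul_eq_zero, hs, false_or] at h
  simpa [Matrix.sum_apply, mul_comm] using h

open scoped Classical in
-- From `U Uᴴ = 1`, `U (Uᴴ U - 1) = 0`, and `U` is injective. This avoids needing equally many rows
-- and columns, which is deduced afterwards.
lemma conjTranspose_mul_qft (hR : ∀ l, (R l).toClass = l) :
    (qft R).conjTranspose * qft R = 1 := by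
  rw [← sub_eq_zero]
  ext x y
  have h : (qft R).mulVec (((qft R).conjTranspose * qft R - 1).col y) = 0 := by
    rw [← Matrix.mulVec_single_one, Matrix.mulVec_mulVec, Matrix.mul_sub, ← Matrix.mul_assoc,
      qft_mul_conjTranspose hR, Matrix.one_mul, Matrix.mul_one, sub_self, Matrix.zero_mulVec]
  exact congrFun (qft_mulVec_injective hR h) x

/-- The sum of the squares of the dimensions of the irreps is the order of the group. -/
lemma sum_dim_sq (hR : ∀ l, (R l).toClass = l) :
    ∑ l : IrrepClass G, l.dim ^ 2 = Fintype.card G := by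
  classical
  -- Both products are identities, so their traces count rows and columns.
  have h := Matrix.trace_mul_comm (qft R) (qft R).conjTranspose
  rw [qft_mul_conjTranspose hR, conjTranspose_mul_qft hR, Matrix.trace_one, Matrix.trace_one,
    Nat.cast_inj] at h
  rw [← h, Fintype.card_sigma, Fintype.sum_sigma]
  refine Finset.sum_congr rfl fun l _ => ?_
  have : l.dim = (R l).dim := by rw [← toClass_dim, hR]
  simp [this, sq]

/-- The dimension cancels: `√(d/|G|) · |G|/√(2d) = √(|G|/2)`. -/
lemma exists_unit_vector_qft (R : IrrepClass G → UnitaryIrrep G) (l : IrrepClass G)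
    (i : Fin (R l).dim) :
    ∃ ψ : EuclideanSpace ℂ (Fin (R l).dim), ‖ψ‖ = 1 ∧
      1 / Real.sqrt 2 * Real.sqrt (Fintype.card G) ≤
        ∑ g, ‖∑ j, star (ψ j) * qft R ⟨⟨l, i⟩, j⟩ g‖ := by
  obtain ⟨ψ, hψ, h⟩ := exists_unit_vector_overlap (R l).dim_pos
    (fun g j => ((R l).mat g).1 i j) fun g => sum_normSq_row (R l) g i
  refine ⟨ψ, hψ, ?_⟩
  have hG : 0 < Real.sqrt (Fintype.card G) := Real.sqrt_pos.mpr (by exact_mod_cast Fintype.card_pos)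
  have h2 : 0 < Real.sqrt 2 := by positivity
  have e : ∀ g, ‖∑ j, star (ψ j) * qft R ⟨⟨l, i⟩, j⟩ g‖ =
      Real.sqrt (R l).dim / Real.sqrt (Fintype.card G) *
        ‖∑ j, star (ψ j) * ((R l).mat g).1 i j‖ := fun g => by
    simp only [qft_apply, mul_left_comm (star _)]
    rw [← Finset.mul_sum, norm_mul, Complex.norm_real, Real.norm_of_nonneg (Real.sqrt_nonneg _),
      Real.sqrt_div (Nat.cast_nonneg _)]
  simp only [e]
  rw [← Finset.mul_sum, div_mul_eq_mul_div, div_mul_eq_mul_div, div_le_div_iff₀ h2 hG, one_mul,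
    Real.mul_self_sqrt (Nat.cast_nonneg _)]
  linarith

lemma card_le_sum_dim_sq (hR : ∀ l, (R l).toClass = l) :
    (Fintype.card G : ℝ) ≤ (∑ l : IrrepClass G, (l.dim : ℝ)) ^ 2 := by
  have h : (Fintype.card G : ℝ) = ∑ l : IrrepClass G, (l.dim : ℝ) ^ 2 := by
    exact_mod_cast (sum_dim_sq hR).symm
  rw [h]
  exact Finset.sum_sq_le_sq_sum_of_nonneg fun l _ => Nat.cast_nonneg _

lemma sum_dim_le_card (hR : ∀ l, (R l).toClass = l) :
    ∑ l : IrrepClass G, (l.dim : ℝ) ≤ Fintype.card G := by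
  have h : (Fintype.card G : ℝ) = ∑ l : IrrepClass G, (l.dim : ℝ) ^ 2 := by
    exact_mod_cast (sum_dim_sq hR).symm
  rw [h]
  refine Finset.sum_le_sum fun l _ => ?_
  exact_mod_cast Nat.le_self_pow two_ne_zero _

end QFT

end QuantumFourier

theorem theorem3 {G : Type*} [Group G] [Fintype G] [Nontrivial G]
    (R : QuantumFourier.IrrepClass G → QuantumFourier.UnitaryIrrep G)
    (hR : ∀ l, (R l).toClass = l) :
    1 / 2 ≤ Real.log (∑ l : QuantumFourier.IrrepClass G, (l.dim : ℝ)) /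
        Real.log (Fintype.card G : ℝ) ∧
      QuantumFourier.IsPseudoDispersing (QuantumFourier.qft R)
        (Real.log (∑ l : QuantumFourier.IrrepClass G, (l.dim : ℝ)) /
          Real.log (Fintype.card G : ℝ))
        (1 / Real.sqrt 2) := by
  have hN : (1 : ℝ) < Fintype.card G := by exact_mod_cast Fintype.one_lt_card
  have hlog := Real.log_pos hN
  have h1 := QuantumFourier.card_le_sum_dim_sq hR
  have h2 := QuantumFourier.sum_dim_le_card hR
  have hS0 : 0 ≤ ∑ l : QuantumFourier.IrrepClass G, (l.dim : ℝ) :=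
    Finset.sum_nonneg fun l _ => Nat.cast_nonneg _
  have hcard : (Fintype.card (Σ l : QuantumFourier.IrrepClass G, Fin (R l).dim) : ℝ) =
      ∑ l : QuantumFourier.IrrepClass G, (l.dim : ℝ) := by
    rw [Fintype.card_sigma, Nat.cast_sum]
    refine Finset.sum_congr rfl fun l _ => ?_
    rw [Fintype.card_fin, ← QuantumFourier.toClass_dim, hR]
  generalize (∑ l : QuantumFourier.IrrepClass G, (l.dim : ℝ)) = S at *
  have hS : 0 < S := hS0.lt_of_ne (by rintro rfl; norm_num at h1)
  have hhalf : 1 / 2 ≤ Real.log S / Real.log (Fintype.card G : ℝ) := by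
    rw [div_le_div_iff₀ two_pos hlog]
    have := Real.log_le_log (by linarith) h1
    rw [Real.log_pow] at this
    push_cast at this
    linarith
  refine ⟨hhalf, by linarith, ?_, by positivity, ?_, ?_, ?_, Finset.univ, ?_, ?_⟩
  · rw [div_le_one hlog]
    exact Real.log_le_log hS h2
  · rw [div_le_one (by positivity), Real.one_le_sqrt]
    norm_num
  · convert QuantumFourier.conjTranspose_mul_qft hR
  · convert QuantumFourier.qft_mul_conjTranspose hR
  -- Equality holds here: `|G|^α = exp (log S) = S`, the number of labels.
  · rw [Finset.card_univ, hcard, Real.rpow_def_of_pos (by linarith), mul_div_cancel₀ _ hlog.ne',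
      Real.exp_log hS]
  · rintro ⟨l, i⟩ -
    exact QuantumFourier.exists_unit_vector_qft R l i
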